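/- Let $\mu=(\mu_1,\dots,\mu_p)$ be a random vector with independent real components, $f:\mathbb R^p\to\mathbb R$ measurable and $Y=f(\mu)$, with $\mathbb E(Y^4)<\infty$ and $\operatorname{Var}Y>0$. Let $f(\mu)=\sum_{\mathfrak u\subseteq\{1,\dots,p\}}f_{\mathfrak u}(\mu_{\mathfrak u})$ be the (Hoeffding–Sobol') ANOVA decomposition, $f_{\mathfrak u}(\mu_{\mathfrak u})=\sum_{\mathfrak v\subseteq\mathfrak u}(-1)^{|\mathfrak u|-|\mathfrak v|}\,\mathbb E(Y\mid\mu_{\mathfrak v})$, and put $$S_{\mathfrak u}=\frac{\operatorname{Var} f_{\mathfrak u}(\mu_{\mathfrak u})}{\operatorname{Var}Y},\qquad S^{\rm closed}_{\mathfrak u}=\sum_{\mathfrak v\subseteq\mathfrak u}S_{\mathfrak v},\qquad S^{\rm tot}_{\{i\}}=\sum_{\mathfrak v\ni i}S_{\mathfrak v}.$$ Let $\mu_i^{j,k}$ ($j\ge1$, $k\in\{1,2\}$, $1\le i\le p$) be independent random variables on a probability space, $\mu_i^{j,k}$ being distributed as $\mu_i$. For $\mathfrak u\subseteq\{1,\dots,p\}$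 let $Y^{j,k}_{\mathfrak u}=f(\mu^{j,1}_{\mathfrak u},\mu^{j,k}_{\mathfrak u^c})$ be the value of $f$ at the point whose coordinates are $\mu_i^{j,1}$ for $i\in\mathfrak u$ and $\mu_i^{j,k}$ for $i\notin\mathfrak u$, and let $$\hat S^{\rm closed}_{\mathfrak u,n}=\frac{\frac1n\sum_{j=1}^nY^{j,1}_{\mathfrak u}Y^{j,2}_{\mathfrak u}-\Bigl(\frac1n\sum_{j=1}^n\frac{Y^{j,1}_{\mathfrak u}+Y^{j,2}_{\mathfrak u}}2\Bigr)^2}{\frac1n\sum_{j=1}^n\frac{(Y^{j,1}_{\mathfrak u})^2+(Y^{j,2}_{\mathfrak u})^2}2-\Bigl(\frac1n\sum_{j=1}^n\frac{Y^{j,1}_{\mathfrak u}+Y^{j,2}_{\mathfrak u}}2\Bigr)^2},\qquad \hat S^{\rm tot}_{\{i\},n}=1-\hat S^{\rm closed}_{\{i\}^c,n}.$$ With $Y_{\mathfrak u}=f(\mu_{\mathfrak u},\mu'_{\mathfrak u^c})$, $\mu'$ an independent copy of $\mu$, let $v_{\mathfrak u}\ge0$ be defined by $$v_{\mathfrak u}^2=\frac{\operatorname{Var}\Bigl((Y-\mathbb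 EY)(Y_{\mathfrak u}-\mathbb EY)-\frac{S^{\rm closed}_{\mathfrak u}}2\bigl((Y-\mathbb EY)^2+(Y_{\mathfrak u}-\mathbb EY)^2\bigr)\Bigr)}{(\operatorname{Var}Y)^2}.$$ Let $\alpha\in(0,1)$ and let $z_{1-\alpha/2}$ be the $(1-\frac\alpha2)$-quantile of $\mathcal N(0,1)$. (i) Let $\mathfrak u\subseteq\{1,\dots,p\}$ and let $\hat v_{\mathfrak u}=\hat v_{\mathfrak u,n}$ be a consistent estimator of $v_{\mathfrak u}$ (that is, $\hat v_{\mathfrak u,n}\to v_{\mathfrak u}$ in probability). Then $$I_n=\Bigl[\hat S^{\rm closed}_{\mathfrak u,n}-z_{1-\alpha/2}\frac{\hat v_{\mathfrak u}}{\sqrt n},\ \hat S^{\rm closed}_{\mathfrak u,n}+z_{1-\alpha/2}\frac{\hat v_{\mathfrak u}}{\sqrt n}\Bigr]$$ is an asymptotic confidence interval of level $1-\alpha$ for $S^{\rm closed}_{\mathfrak u}$: if $v_{\mathfrak u}>0$, then $\mathbb P(S^{\rm closed}_{\mathfrak u}\in I_n)\to1-\alpha$ as $n\to\infty$; and, whether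 or not $v_{\mathfrak u}=0$, if $\hat v_{\mathfrak u}\ge0$ almost surely, then $\liminf_{n\to\infty}\mathbb P(S^{\rm closed}_{\mathfrak u}\in I_n)\ge1-\alpha$. (ii) Let $i\in\{1,\dots,p\}$ and let $\hat v_{\sim i}$ be a consistent estimator of $v_{\sim i}:=v_{\mathfrak u}$ with $\mathfrak u=\{1,\dots,p\}\setminus\{i\}$. Then $$\Bigl[\hat S^{\rm tot}_{\{i\},n}-z_{1-\alpha/2}\frac{\hat v_{\sim i}}{\sqrt n},\ \hat S^{\rm tot}_{\{i\},n}+z_{1-\alpha/2}\frac{\hat v_{\sim i}}{\sqrt n}\Bigr]$$ is, in the same sense, an asymptotic confidence interval of level $1-\alpha$ for $S^{\rm tot}_{\{i\}}$ (exact limit $1-\alpha$ if $v_{\sim i}>0$; lower limit at least $1-\alpha$ if $\hat v_{\sim i}\ge0$ almost surely). -/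

import Mathlib

open MeasureTheory ProbabilityTheory Filter Topology

namespace Sobol

noncomputable section

variable {p : ℕ}

/-- The law of the input vector `μ = (μ₁, …, μ_p)`: its components are independent and the `i`-th
one has law `ν i`, so the law of `μ` is the product measure. -/
def inputLaw (ν : Fin p → Measure ℝ) : Measure (Fin p → ℝ) := Measure.pi ν

/-- `E(Y | μ_u = x_u)` for `Y = f(μ)`: since the inputs are independent, the coordinates in `u`
are frozen at `x` and the other ones are integrated out. -/
def condMean (ν : Fin p → Measure ℝ) (f : (Fin p → ℝ) → ℝ) (u : Finset (Fin p))
    (x : Fin p → ℝ) : ℝ :=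
  ∫ y, f (u.piecewise x y) ∂(inputLaw ν)

/-- The component `f_u` of the (Hoeffding–Sobol') ANOVA decomposition `f = ∑ u, f_u`:
`f_u = ∑_{v ⊆ u} (-1)^{|u| - |v|} E(Y | μ_v)`. -/
def anova (ν : Fin p → Measure ℝ) (f : (Fin p → ℝ) → ℝ) (u : Finset (Fin p))
    (x : Fin p → ℝ) : ℝ :=
  ∑ v ∈ u.powerset, (-1 : ℝ) ^ (u.card - v.card) * condMean ν f v x

/-- The Sobol' index `S_u = Var(f_u(μ_u)) / Var(Y)`. -/
def index (ν : Fin p → Measure ℝ) (f : (Fin p → ℝ) → ℝ) (u : Finset (Fin p)) : ℝ :=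
  variance (anova ν f u) (inputLaw ν) / variance f (inputLaw ν)

/-- The closed Sobol' index `S_u^closed = ∑_{v ⊆ u} S_v`. -/
def closedIndex (ν : Fin p → Measure ℝ) (f : (Fin p → ℝ) → ℝ) (u : Finset (Fin p)) : ℝ :=
  ∑ v ∈ u.powerset, index ν f v

/-- The total Sobol' index `S_i^tot = ∑_{v ∋ i} S_v`. -/
def totalIndex (ν : Fin p → Measure ℝ) (f : (Fin p → ℝ) → ℝ) (i : Fin p) : ℝ :=
  ∑ v : Finset (Fin p) with i ∈ v, index ν f v

/-- The limit variance `v_u²`. Here `Y = f(μ)` and `Y_u = f(μ_u, μ'_{uᶜ})`, where `μ'` is an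
independent copy of `μ`. -/
def limitVar (ν : Fin p → Measure ℝ) (f : (Fin p → ℝ) → ℝ) (u : Finset (Fin p)) : ℝ :=
  variance
    (fun z : (Fin p → ℝ) × (Fin p → ℝ) =>
      (f z.1 - ∫ x, f x ∂(inputLaw ν)) * (f (u.piecewise z.1 z.2) - ∫ x, f x ∂(inputLaw ν))
        - closedIndex ν f u / 2 *
          ((f z.1 - ∫ x, f x ∂(inputLaw ν)) ^ 2
            + (f (u.piecewise z.1 z.2) - ∫ x, f x ∂(inputLaw ν)) ^ 2))
    ((inputLaw ν).prod (inputLaw ν))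
  / (variance f (inputLaw ν)) ^ 2

variable {Ω : Type*}

/-- The pick-freeze outputs `Y_u^{j,k} = f(μ_u^{j,1}, μ_{uᶜ}^{j,k})`. The random variable
`X j k i` is the draw `μ_i^{j,k}`; draws `j` are numbered from `0`, and `k = 0, 1` stand for the
first and the second sample. -/
def output (f : (Fin p → ℝ) → ℝ) (X : ℕ → Fin 2 → Fin p → Ω → ℝ) (u : Finset (Fin p))
    (j : ℕ) (k : Fin 2) (ω : Ω) : ℝ :=
  f (u.piecewise (fun i => X j 0 i ω) (fun i => X j k i ω))

/-- The pick-freeze estimator of the closed Sobol' index from a sample of size `n`. -/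
def closedEstimator (f : (Fin p → ℝ) → ℝ) (X : ℕ → Fin 2 → Fin p → Ω → ℝ)
    (u : Finset (Fin p)) (n : ℕ) (ω : Ω) : ℝ :=
  ((1 / (n : ℝ)) * ∑ j ∈ Finset.range n, output f X u j 0 ω * output f X u j 1 ω
      - ((1 / (n : ℝ)) *
          ∑ j ∈ Finset.range n, (output f X u j 0 ω + output f X u j 1 ω) / 2) ^ 2)
  / ((1 / (n : ℝ)) *
        ∑ j ∈ Finset.range n, (output f X u j 0 ω ^ 2 + output f X u j 1 ω ^ 2) / 2
      - ((1 / (n : ℝ)) *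
          ∑ j ∈ Finset.range n, (output f X u j 0 ω + output f X u j 1 ω) / 2) ^ 2)

/-- The estimator `1 - Ŝ^closed` of the total index, with `Ŝ^closed` taken at `{i}ᶜ`. -/
def totalEstimator (f : (Fin p → ℝ) → ℝ) (X : ℕ → Fin 2 → Fin p → Ω → ℝ)
    (i : Fin p) (n : ℕ) (ω : Ω) : ℝ :=
  1 - closedEstimator f X {i}ᶜ n ω

/-- The quantile of order `q` of the standard normal distribution. -/
def normalQuantile (q : ℝ) : ℝ := sInf {x : ℝ | q ≤ cdf (gaussianReal 0 1) x}

/-- The interval `[est - z v̂/√n, est + z v̂/√n]` with `z = z_{1-α/2}`. -/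
def confInterval (α : ℝ) (est vhat : ℕ → Ω → ℝ) (n : ℕ) (ω : Ω) : Set ℝ :=
  Set.Icc (est n ω - normalQuantile (1 - α / 2) * (vhat n ω / √(n : ℝ)))
    (est n ω + normalQuantile (1 - α / 2) * (vhat n ω / √(n : ℝ)))

variable [MeasurableSpace Ω]

/-- The random sets `I n` cover `θ` with a probability that tends to `level`. -/
def IsAsymptoticCI (P : Measure Ω) (I : ℕ → Ω → Set ℝ) (θ level : ℝ) : Prop :=
  Tendsto (fun n => P.real {ω | θ ∈ I n ω}) atTop (𝓝 level)

/-- The random sets `I n` cover `θ` with a probability whose lower limit is at least `level`. -/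
def IsAsymptoticCIAtLeast (P : Measure Ω) (I : ℕ → Ω → Set ℝ) (θ level : ℝ) : Prop :=
  ∀ c < level, ∀ᶠ n in atTop, c < P.real {ω | θ ∈ I n ω}

/-- `vhat n` is a sequence of random variables that converges to `v` in probability. -/
def IsConsistent (P : Measure Ω) (vhat : ℕ → Ω → ℝ) (v : ℝ) : Prop :=
  (∀ n, AEMeasurable (vhat n) P) ∧ TendstoInMeasure P vhat atTop (fun _ => v)

end

end Sobol

/-! Let `N` and `D` be the numerator and denominator of the estimator and `S` the closed index. No
delta method is needed: where `D > 0`, `S` lies in the interval iff `|√n (N - S D)| ≤ z v̂ D`. As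
`N` and `D` are unchanged when `f` is shifted by a constant, `√n (N - S D)` equals `n^{-1/2} ∑
gap(Z_j)` plus `(S - 1) √n` times the square of a centered empirical mean
(`sqrt_mul_num_sub_mul_den`). The `Z_j` are i.i.d. pairs of inputs and `gap` has mean `Cov(Y, Y_u) -
S Var Y = 0`, so the CLT applies to the first term, while the second has `L¹` norm of order
`n^{-1/2}`. With `D → Var Y` and `v̂ → v`, Slutsky's lemma gives the limit `P(|N(0,1)| ≤ z) = 1 - α`
if `v > 0`.

The identity `Cov(Y, Y_u) = S Var Y` comes from `E_v E_w = E_{v ∩ w}` for conditional expectations,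
followed by Möbius inversion over subsets.

If `v = 0`, then `gap = 0` a.s. Three outputs sharing `μ_u` then satisfy a quadratic relation
pairwise, which is incompatible with `Var Y > 0` unless `S = 1`. In that case `gap = -(Y - Y_u)²/2`,
so `Y = Y_u` a.s., the estimator is exactly `1` where `D > 0`, and any interval with `v̂ ≥ 0`
covers.

The total index reduces to the closed one by the reflection `θ ↦ 1 - θ`. -/

namespace Sobol

/-! ### ANOVA decomposition and the pick-freeze identity. -/

section Anova

lemma closedIndex_nonneg {p : ℕ} (ν : Fin p → Measure ℝ) (f : (Fin p → ℝ) → ℝ)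
    (u : Finset (Fin p)) : 0 ≤ closedIndex ν f u :=
  Finset.sum_nonneg fun _ _ => div_nonneg (variance_nonneg _ _) (variance_nonneg _ _)

variable {p : ℕ} (ν : Fin p → Measure ℝ) [∀ i, IsProbabilityMeasure (ν i)]

instance : IsProbabilityMeasure (inputLaw ν) := by
  unfold inputLaw; infer_instance

/-- Exchanging the coordinates outside `v` between two independent copies preserves their law. -/
lemma measurePreserving_piecewise_swap (v : Finset (Fin p)) :
    MeasurePreserving
      (fun z : (Fin p → ℝ) × (Fin p → ℝ) => (v.piecewise z.1 z.2, v.piecewise z.2 z.1))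
      ((inputLaw ν).prod (inputLaw ν)) ((inputLaw ν).prod (inputLaw ν)) := by
  -- Two independent vectors are a vector of `p` independent pairs; swapping a pair of i.i.d.
  -- entries preserves its law.
  have e := measurePreserving_arrowProdEquivProdArrow ℝ ℝ (Fin p) ν ν
  have c : MeasurePreserving
      (fun (a : Fin p → ℝ × ℝ) i => (if i ∈ v then id else Prod.swap) (a i))
      (Measure.pi fun i => (ν i).prod (ν i)) (Measure.pi fun i => (ν i).prod (ν i)) := by
    refine measurePreserving_pi _ _ fun i => ?_
    split_ifs
    · exact MeasurePreserving.id _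
    · exact Measure.measurePreserving_swap
  have h := e.comp (c.comp (e.symm _))
  have heq : (fun z : (Fin p → ℝ) × (Fin p → ℝ) =>
      (v.piecewise z.1 z.2, v.piecewise z.2 z.1)) =
      (MeasurableEquiv.arrowProdEquivProdArrow ℝ ℝ (Fin p)) ∘
      (fun (a : Fin p → ℝ × ℝ) i => (if i ∈ v then id else Prod.swap) (a i)) ∘
      (MeasurableEquiv.arrowProdEquivProdArrow ℝ ℝ (Fin p)).symm := by
    funext z
    apply Prod.ext <;> funext i <;> by_cases hi : i ∈ v <;>
      simp [hi, MeasurableEquiv.arrowProdEquivProdArrow, Equiv.arrowProdEquivProdArrow]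
  rw [heq]
  exact h

lemma measurePreserving_piecewise (v : Finset (Fin p)) :
    MeasurePreserving (fun z : (Fin p → ℝ) × (Fin p → ℝ) => v.piecewise z.1 z.2)
      ((inputLaw ν).prod (inputLaw ν)) (inputLaw ν) :=
  measurePreserving_fst.comp (measurePreserving_piecewise_swap ν v)

variable {ν} {f g : (Fin p → ℝ) → ℝ}

lemma stronglyMeasurable_condMean (hf : Measurable f) (v : Finset (Fin p)) :
    StronglyMeasurable (condMean ν f v) :=
  (hf.comp (measurePreserving_piecewise ν v).measurable).stronglyMeasurable.integral_prod_right'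

lemma integrable_piecewise (hf : Integrable f (inputLaw ν)) (v : Finset (Fin p)) :
    Integrable (fun z : (Fin p → ℝ) × (Fin p → ℝ) => f (v.piecewise z.1 z.2))
      ((inputLaw ν).prod (inputLaw ν)) :=
  (measurePreserving_piecewise ν v).integrable_comp_of_integrable hf

lemma memLp_piecewise {q : ENNReal} (hf : MemLp f q (inputLaw ν)) (v : Finset (Fin p)) :
    MemLp (fun z : (Fin p → ℝ) × (Fin p → ℝ) => f (v.piecewise z.1 z.2)) q
      ((inputLaw ν).prod (inputLaw ν)) :=
  hf.comp_measurePreserving (measurePreserving_piecewise ν v)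

lemma sq_integral_le_integral_sq {Ω : Type*} [MeasurableSpace Ω] {P : Measure Ω}
    [IsProbabilityMeasure P] {X : Ω → ℝ} (hX : MemLp X 2 P) :
    (∫ ω, X ω ∂P) ^ 2 ≤ ∫ ω, X ω ^ 2 ∂P := by
  have := variance_nonneg X P
  rw [variance_eq_sub hX] at this
  simpa using this

/-- Jensen's inequality on almost every section: `E(Y | μ_v)² ≤ E(Y² | μ_v)`. -/
lemma memLp_condMean (hf : Measurable f) (hf2 : MemLp f 2 (inputLaw ν)) (v : Finset (Fin p)) :
    MemLp (condMean ν f v) 2 (inputLaw ν) := by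
  rw [memLp_two_iff_integrable_sq (stronglyMeasurable_condMean hf v).aestronglyMeasurable]
  have h2 := integrable_piecewise (hf2.integrable_sq) v
  refine h2.integral_prod_left.mono'
    ((stronglyMeasurable_condMean hf v).pow 2).aestronglyMeasurable ?_
  filter_upwards [h2.prod_right_ae] with x hx
  rw [Real.norm_of_nonneg (sq_nonneg _)]
  refine sq_integral_le_integral_sq ((memLp_two_iff_integrable_sq ?_).2 hx)
  exact ((hf.comp (measurePreserving_piecewise ν v).measurable).comp
    measurable_prodMk_left).aestronglyMeasurable

lemma integral_condMean (hf : Integrable f (inputLaw ν)) (v : Finset (Fin p)) :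
    ∫ x, condMean ν f v x ∂(inputLaw ν) = ∫ x, f x ∂(inputLaw ν) := by
  unfold condMean
  rw [← integral_prod _ (integrable_piecewise hf v)]
  exact (measurePreserving_piecewise ν v).hasLaw.integral_comp hf.aestronglyMeasurable

lemma integral_mul_condMean (hf : MemLp f 2 (inputLaw ν)) (hg : MemLp g 2 (inputLaw ν))
    (v : Finset (Fin p)) :
    ∫ x, g x * condMean ν f v x ∂(inputLaw ν) =
      ∫ z, g z.1 * f (v.piecewise z.1 z.2) ∂((inputLaw ν).prod (inputLaw ν)) := by
  have hi : Integrable (fun z : (Fin p → ℝ) × (Fin p → ℝ) => g z.1 * f (v.piecewise z.1 z.2))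
      ((inputLaw ν).prod (inputLaw ν)) :=
    (hg.comp_measurePreserving measurePreserving_fst).integrable_mul (memLp_piecewise hf v)
  rw [integral_prod _ hi]
  simp only [integral_const_mul, condMean]

/-- `E(· | μ_v)` is self-adjoint. -/
lemma integral_mul_condMean_comm (hf : MemLp f 2 (inputLaw ν)) (hg : MemLp g 2 (inputLaw ν))
    (v : Finset (Fin p)) :
    ∫ x, g x * condMean ν f v x ∂(inputLaw ν) = ∫ x, f x * condMean ν g v x ∂(inputLaw ν) := by
  rw [integral_mul_condMean hf hg, integral_mul_condMean hg hf]
  have hi : Integrable (fun z : (Fin p → ℝ) × (Fin p → ℝ) => g z.1 * f (v.piecewise z.1 z.2))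
      ((inputLaw ν).prod (inputLaw ν)) :=
    (hg.comp_measurePreserving measurePreserving_fst).integrable_mul (memLp_piecewise hf v)
  -- The swap is an involution, so this change of variables exchanges `z.1` and its mixture with
  -- `z.2`.
  rw [← (measurePreserving_piecewise_swap ν v).hasLaw.integral_comp hi.aestronglyMeasurable]
  refine integral_congr_ae (ae_of_all _ fun z => ?_)
  simp only [Function.comp_apply]
  have : v.piecewise (v.piecewise z.1 z.2) (v.piecewise z.2 z.1) = z.1 := by
    funext i; by_cases hi : i ∈ v <;> simp [hi]
  rw [this, mul_comm]

/-- Freezing `w` after `v` freezes only `v ∩ w`, the rest being fresh independent coordinates. Only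
almost everywhere, since Fubini needs an integrable section at `x`. -/
lemma condMean_condMean (hf : Integrable f (inputLaw ν)) (v w : Finset (Fin p)) :
    condMean ν (condMean ν f w) v =ᵐ[inputLaw ν] condMean ν f (v ∩ w) := by
  filter_upwards [(integrable_piecewise hf (v ∩ w)).prod_right_ae] with x hx
  have key : ∀ y y' : Fin p → ℝ, w.piecewise (v.piecewise x y) y' =
      (v ∩ w).piecewise x (w.piecewise y y') := by
    intro y y'
    funext i
    by_cases h1 : i ∈ v <;> by_cases h2 : i ∈ w <;> simp [h1, h2]
  simp only [condMean, key]
  rw [← integral_prod (fun z : (Fin p → ℝ) × (Fin p → ℝ) =>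
    f ((v ∩ w).piecewise x (w.piecewise z.1 z.2)))
    ((measurePreserving_piecewise ν w).integrable_comp_of_integrable hx)]
  exact (measurePreserving_piecewise ν w).hasLaw.integral_comp hx.aestronglyMeasurable

/-- The covariance of `f(μ)` and `E(f(μ) | μ_v)`. -/
noncomputable def closedVar (ν : Fin p → Measure ℝ) (f : (Fin p → ℝ) → ℝ)
    (v : Finset (Fin p)) : ℝ :=
  cov[f, condMean ν f v; inputLaw ν]

/-- Self-adjointness moves `E_v` across: `⟨E_v f, E_w f⟩ = ⟨f, E_v E_w f⟩ = ⟨f, E_{v ∩ w} f⟩`. -/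
lemma covariance_condMean (hf : Measurable f) (hf2 : MemLp f 2 (inputLaw ν))
    (v w : Finset (Fin p)) :
    cov[condMean ν f v, condMean ν f w; inputLaw ν] = closedVar ν f (v ∩ w) := by
  have hi := hf2.integrable one_le_two
  rw [closedVar, covariance_eq_sub (memLp_condMean hf hf2 v) (memLp_condMean hf hf2 w),
    covariance_eq_sub hf2 (memLp_condMean hf hf2 _)]
  simp only [integral_condMean hi, Pi.mul_apply]
  congr 1
  have := integral_mul_condMean_comm hf2 (memLp_condMean hf hf2 w) v
  calc _ = ∫ x, condMean ν f w x * condMean ν f v x ∂(inputLaw ν) := by simp only [mul_comm]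
    _ = _ := by
      rw [this]
      refine integral_congr_ae ?_
      filter_upwards [condMean_condMean hi v w] with x hx
      rw [hx]

lemma sum_powerset_moebius {ι : Type*} [DecidableEq ι] (t : Finset ι) :
    ∀ G : Finset ι → ℝ,
    ∑ u ∈ t.powerset, ∑ v ∈ u.powerset, (-1 : ℝ) ^ (u.card - v.card) * G v = G t := by
  induction t using Finset.induction_on with
  | empty => intro G; simp
  | insert a t ha ih =>
    intro G
    rw [Finset.sum_powerset_insert ha, ← Finset.sum_add_distrib, ← ih (fun v => G (insert a v))]
    refine Finset.sum_congr rfl fun u hu => ?_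
    have hau : a ∉ u := fun h => ha (Finset.mem_powerset.1 hu h)
    rw [Finset.sum_powerset_insert hau, ← add_assoc, ← Finset.sum_add_distrib]
    -- A set `v` without `a` occurs under both `u` and `insert a u`, with opposite signs; only the
    -- sets `insert a v` survive.
    rw [Finset.sum_eq_zero, zero_add]
    · refine Finset.sum_congr rfl fun v hv => ?_
      have hav : a ∉ v := fun h => hau (Finset.mem_powerset.1 hv h)
      rw [Finset.card_insert_of_notMem hau, Finset.card_insert_of_notMem hav,
        Nat.add_sub_add_right]
    · intro v hv
      have := Finset.card_le_card (Finset.mem_powerset.1 hv)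
      rw [Finset.card_insert_of_notMem hau, Nat.sub_add_comm this, pow_succ]
      ring

/-- The sets `w` and `insert a w` meet `v` in the same set and carry opposite signs. This yields the
orthogonality of `f_u` to `E(Y | μ_v)` when `u ⊄ v`. -/
lemma sum_powerset_alternating_inter {ι : Type*} [DecidableEq ι] {u v : Finset ι} {a : ι}
    (hau : a ∈ u) (hav : a ∉ v) (G : Finset ι → ℝ) :
    ∑ w ∈ u.powerset, (-1 : ℝ) ^ (u.card - w.card) * G (w ∩ v) = 0 := by
  obtain ⟨t, hat, rfl⟩ : ∃ t, a ∉ t ∧ insert a t = u :=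
    ⟨u.erase a, Finset.notMem_erase a u, Finset.insert_erase hau⟩
  rw [Finset.sum_powerset_insert hat, ← Finset.sum_add_distrib]
  refine Finset.sum_eq_zero fun w hw => ?_
  have haw : a ∉ w := fun h => hat (Finset.mem_powerset.1 hw h)
  have := Finset.card_le_card (Finset.mem_powerset.1 hw)
  rw [Finset.card_insert_of_notMem hat, Finset.card_insert_of_notMem haw,
    Finset.insert_inter_of_notMem hav, Nat.add_sub_add_right, Nat.sub_add_comm this, pow_succ]
  ring

lemma memLp_anova (hf : Measurable f) (hf2 : MemLp f 2 (inputLaw ν)) (u : Finset (Fin p)) :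
    MemLp (anova ν f u) 2 (inputLaw ν) :=
  memLp_finsetSum _ fun v _ => (memLp_condMean hf hf2 v).const_mul _

lemma covariance_anova_condMean (hf : Measurable f) (hf2 : MemLp f 2 (inputLaw ν))
    (u v : Finset (Fin p)) :
    cov[anova ν f u, condMean ν f v; inputLaw ν] =
      ∑ w ∈ u.powerset, (-1 : ℝ) ^ (u.card - w.card) * closedVar ν f (w ∩ v) := by
  unfold anova
  rw [covariance_fun_sum_left' (fun w _ => (memLp_condMean hf hf2 w).const_mul _)
    (memLp_condMean hf hf2 v)]
  simp only [covariance_const_mul_left, covariance_condMean hf hf2]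

lemma variance_anova (hf : Measurable f) (hf2 : MemLp f 2 (inputLaw ν)) (u : Finset (Fin p)) :
    variance (anova ν f u) (inputLaw ν) =
      ∑ v ∈ u.powerset, (-1 : ℝ) ^ (u.card - v.card) * closedVar ν f v := by
  rw [← covariance_self (memLp_anova hf hf2 u).aemeasurable]
  have h : cov[anova ν f u, anova ν f u; inputLaw ν] =
      ∑ v ∈ u.powerset, (-1 : ℝ) ^ (u.card - v.card) *
        cov[anova ν f u, condMean ν f v; inputLaw ν] := by
    conv_lhs => enter [2]; unfold anova
    rw [covariance_fun_sum_right' (fun w _ => (memLp_condMean hf hf2 w).const_mul _)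
      (memLp_anova hf hf2 u)]
    simp only [covariance_const_mul_right]
  -- Only one factor is expanded: `f_u` is uncorrelated with `E(Y | μ_v)` for proper `v ⊂ u`.
  rw [h, Finset.sum_eq_single u]
  · rw [covariance_anova_condMean hf hf2, Nat.sub_self, pow_zero, one_mul]
    refine Finset.sum_congr rfl fun w hw => ?_
    rw [Finset.inter_eq_left.2 (Finset.mem_powerset.1 hw)]
  · intro v hv hne
    obtain ⟨a, hau, hav⟩ := Finset.exists_of_ssubset
      ((Finset.mem_powerset.1 hv).ssubset_of_ne hne)
    rw [covariance_anova_condMean hf hf2, sum_powerset_alternating_inter hau hav, mul_zero]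
  · simp

lemma closedIndex_eq (hf : Measurable f) (hf2 : MemLp f 2 (inputLaw ν)) (u : Finset (Fin p)) :
    closedIndex ν f u = closedVar ν f u / variance f (inputLaw ν) := by
  simp only [closedIndex, index]
  rw [← Finset.sum_div]
  simp only [variance_anova hf hf2, sum_powerset_moebius]

lemma condMean_univ : condMean ν f Finset.univ = f := by
  funext x
  simp [condMean]

lemma closedIndex_univ (hf : Measurable f) (hf2 : MemLp f 2 (inputLaw ν))
    (hvar : variance f (inputLaw ν) ≠ 0) : closedIndex ν f Finset.univ = 1 := by
  rw [closedIndex_eq hf hf2, closedVar, condMean_univ, covariance_self hf.aemeasurable,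
    div_self hvar]

/-- All the indices sum to `1`, and the sets that avoid `i` are the subsets of `{i}ᶜ`. -/
lemma totalIndex_eq (hf : Measurable f) (hf2 : MemLp f 2 (inputLaw ν))
    (hvar : variance f (inputLaw ν) ≠ 0) (i : Fin p) :
    totalIndex ν f i = 1 - closedIndex ν f {i}ᶜ := by
  rw [← closedIndex_univ hf hf2 hvar, totalIndex, closedIndex, closedIndex, Finset.powerset_univ,
    ← Finset.sum_filter_add_sum_filter_not Finset.univ (fun v : Finset (Fin p) => i ∈ v)]
  rw [add_sub_assoc, left_eq_add, sub_eq_zero]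
  refine Finset.sum_congr ?_ fun _ _ => rfl
  ext v
  simp [Finset.subset_compl_singleton]

/-- The pick-freeze identity: `E(Y Y_u) = E(Y E(Y | μ_u))`, because `Y_u` redraws the coordinates
outside `u`. -/
lemma integral_mul_comp_piecewise (hf : Measurable f) (hf2 : MemLp f 2 (inputLaw ν))
    (hvar : variance f (inputLaw ν) ≠ 0) (u : Finset (Fin p)) :
    ∫ z, f z.1 * f (u.piecewise z.1 z.2) ∂((inputLaw ν).prod (inputLaw ν)) =
      closedIndex ν f u * variance f (inputLaw ν) + (∫ x, f x ∂(inputLaw ν)) ^ 2 := by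
  rw [closedIndex_eq hf hf2, div_mul_cancel₀ _ hvar, closedVar,
    covariance_eq_sub hf2 (memLp_condMean hf hf2 _),
    integral_condMean (hf2.integrable one_le_two), ← integral_mul_condMean hf2 hf2]
  simp only [Pi.mul_apply]
  ring

end Anova

/-! ### Quantiles of the standard normal law. -/

section NormalQuantile

lemma continuous_cdf {μ : Measure ℝ} [IsProbabilityMeasure μ] [NullSingletonClass μ] :
    Continuous (cdf μ) := by
  rw [continuous_iff_continuousAt]
  intro x
  rw [(cdf μ).mono.continuousAt_iff_leftLim_eq_rightLim, StieltjesFunction.rightLim_eq]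
  have h : (cdf μ).measure {x} = 0 := by rw [measure_cdf]; exact measure_singleton x
  rw [StieltjesFunction.measure_singleton, ENNReal.ofReal_eq_zero, sub_nonpos] at h
  exact le_antisymm ((cdf μ).mono.leftLim_le le_rfl) h

/-- By continuity the value `q` is attained, and the infimum over a closed set bounded below belongs
to it. -/
lemma cdf_normalQuantile {q : ℝ} (hq : q ∈ Set.Ioo (0 : ℝ) 1) :
    cdf (gaussianReal 0 1) (normalQuantile q) = q := by
  have : NullSingletonClass (gaussianReal 0 1) := nullSingletonClass_gaussianReal one_ne_zero
  have hc : Continuous (cdf (gaussianReal 0 1)) := continuous_cdf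
  obtain ⟨a, ha⟩ := ((tendsto_cdf_atBot (gaussianReal 0 1)).eventually_lt_const hq.1).exists
  obtain ⟨b, hb⟩ := ((tendsto_cdf_atTop (gaussianReal 0 1)).eventually_const_lt hq.2).exists
  obtain ⟨x, hx⟩ := mem_range_of_exists_le_of_exists_ge hc ⟨a, ha.le⟩ ⟨b, hb.le⟩
  have hbdd : BddBelow {x : ℝ | q ≤ cdf (gaussianReal 0 1) x} :=
    ⟨a, fun y hy => le_of_lt <| (monotone_cdf _).reflect_lt (ha.trans_le hy)⟩
  have hcl : IsClosed {x : ℝ | q ≤ cdf (gaussianReal 0 1) x} := isClosed_le continuous_const hc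
  have hxm : x ∈ {x : ℝ | q ≤ cdf (gaussianReal 0 1) x} := hx.ge
  refine le_antisymm ?_ (hcl.csInf_mem ⟨x, hxm⟩ hbdd)
  rw [← hx]
  exact monotone_cdf _ (hx ▸ csInf_le hbdd hxm)

lemma cdf_gaussianReal_neg (x : ℝ) :
    cdf (gaussianReal 0 1) (-x) = 1 - cdf (gaussianReal 0 1) x := by
  have : NullSingletonClass (gaussianReal 0 1) := nullSingletonClass_gaussianReal one_ne_zero
  have h : (gaussianReal 0 1).map (fun x => -x) = gaussianReal 0 1 := by
    rw [gaussianReal_map_neg, neg_zero]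
  rw [cdf_eq_real, cdf_eq_real, ← probReal_compl_eq_one_sub measurableSet_Iic, Set.compl_Iic]
  conv_lhs => rw [← h]
  rw [map_measureReal_apply measurable_neg measurableSet_Iic]
  have : (fun x : ℝ => -x) ⁻¹' Set.Iic (-x) = Set.Ici x := by ext; simp
  rw [this]
  exact measureReal_congr Ioi_ae_eq_Ici.symm

lemma normalQuantile_nonneg {q : ℝ} (hq : q ∈ Set.Ioo (2⁻¹ : ℝ) 1) : 0 ≤ normalQuantile q := by
  have h := cdf_normalQuantile ⟨by linarith [hq.1], hq.2⟩
  by_contra! hz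
  have h1 := cdf_gaussianReal_neg (normalQuantile q)
  have h2 := monotone_cdf (gaussianReal 0 1)
    (show normalQuantile q ≤ -normalQuantile q by linarith)
  rw [h1, h] at h2
  linarith [hq.1]

lemma gaussianReal_abs_le {x : ℝ} (hx : 0 ≤ x) :
    (gaussianReal 0 1).real {y | |y| ≤ x} = 2 * cdf (gaussianReal 0 1) x - 1 := by
  have : NullSingletonClass (gaussianReal 0 1) := nullSingletonClass_gaussianReal one_ne_zero
  have hs : {y : ℝ | |y| ≤ x} = Set.Icc (-x) x := by ext; simp [abs_le]
  have hd : Set.Iic x \ Set.Iic (-x) = Set.Ioc (-x) x := by ext; simp [and_comm]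
  rw [hs, measureReal_congr Ioc_ae_eq_Icc.symm, ← hd,
    measureReal_sdiff (Set.Iic_subset_Iic.2 (by linarith)) measurableSet_Iic, ← cdf_eq_real,
    ← cdf_eq_real, cdf_gaussianReal_neg]
  ring

end NormalQuantile

/-! ### Limit theorems and Slutsky arguments. -/

section Asymptotics

section Law

variable {Ω E : Type*} [MeasurableSpace Ω] [MeasurableSpace E] {P : Measure Ω} {κ : Measure E}
  {h : E → ℝ}

lemma identDistrib_comp_of_hasLaw {Z : ℕ → Ω → E}
    (hZ : ∀ j, HasLaw (Z j) κ P) (hh : Measurable h) (j : ℕ) :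
    IdentDistrib (fun ω => h (Z j ω)) (fun ω => h (Z 0 ω)) P P :=
  IdentDistrib.comp ⟨(hZ j).aemeasurable, (hZ 0).aemeasurable,
    (hZ j).map_eq.trans (hZ 0).map_eq.symm⟩ hh

lemma memLp_comp_of_hasLaw {Z : Ω → E} (hZ : HasLaw Z κ P) {q : ENNReal} (hh : MemLp h q κ) :
    MemLp (fun ω => h (Z ω)) q P := by
  have := hZ.map_eq ▸ hh
  exact (memLp_map_measure_iff this.1 hZ.aemeasurable).1 this

lemma ae_tendsto_average {Z : ℕ → Ω → E}
    (hZ : ∀ j, HasLaw (Z j) κ P) (hind : iIndepFun Z P) (hh : Measurable h)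
    (hint : Integrable h κ) :
    ∀ᵐ ω ∂P, Tendsto (fun n : ℕ => 1 / (n : ℝ) * ∑ j ∈ Finset.range n, h (Z j ω)) atTop
      (𝓝 (∫ e, h e ∂κ)) := by
  have h1 : Integrable (fun ω => h (Z 0 ω)) P :=
    memLp_one_iff_integrable.1 (memLp_comp_of_hasLaw (hZ 0) (memLp_one_iff_integrable.2 hint))
  have h2 := strong_law_ae_real (fun j ω => h (Z j ω)) h1
    (fun i j hij => (hind.indepFun hij).comp hh hh) (identDistrib_comp_of_hasLaw hZ hh)
  have h3 : ∫ ω, h (Z 0 ω) ∂P = ∫ e, h e ∂κ := (hZ 0).integral_comp hint.aestronglyMeasurable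
  simp only [h3] at h2
  filter_upwards [h2] with ω hω
  simpa only [one_div_mul_eq_div] using hω

end Law

variable {Ω : Type*} [MeasurableSpace Ω] {P : Measure Ω} [IsProbabilityMeasure P]

/-- Coverage of a studentized statistic, with the denominators cleared. -/
lemma tendsto_measureReal_abs_le {A D V : ℕ → Ω → ℝ} {d v z : ℝ} (hd : 0 < d) (hv : 0 < v)
    (hA : TendstoInDistribution A atTop (fun x : ℝ => v * d * x) (fun _ => P) (gaussianReal 0 1))
    (hD : TendstoInMeasure P D atTop (fun _ => d)) (hDm : ∀ n, AEMeasurable (D n) P)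
    (hV : TendstoInMeasure P V atTop (fun _ => v)) (hVm : ∀ n, AEMeasurable (V n) P) :
    Tendsto (fun n => P.real {ω | |A n ω| ≤ z * (V n ω * D n ω)}) atTop
      (𝓝 ((gaussianReal 0 1).real {x | |x| ≤ z})) := by
  have : NullSingletonClass (gaussianReal 0 1) := nullSingletonClass_gaussianReal one_ne_zero
  have h1 := hA.prodMk_of_tendstoInMeasure_const A D _ hD hDm
  have h2 := h1.continuous_comp_prodMk_of_tendstoInMeasure_const
    (g := fun q : (ℝ × ℝ) × ℝ => |q.1.1| - z * (q.2 * q.1.2)) (by fun_prop) hV hVm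
  -- Portmanteau condition: the limit hits the boundary only at `x = ±z`, a null set; this uses `v d
  -- > 0`.
  have h0 : (gaussianReal 0 1).map (fun x : ℝ => |v * d * x| - z * (v * d))
      (frontier (Set.Iic 0)) = 0 := by
    rw [frontier_Iic, Measure.map_apply (by fun_prop) (measurableSet_singleton _)]
    refine Set.Finite.measure_zero (Set.Finite.subset (Set.toFinite {z, -z}) fun x hx => ?_) _
    have hx : |v * d * x| - z * (v * d) = 0 := hx
    rw [abs_mul, abs_of_pos (mul_pos hv hd), mul_comm z, ← mul_sub, mul_eq_zero] at hx
    have hx := hx.resolve_left (mul_pos hv hd).ne'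
    have := eq_or_eq_neg_of_abs_eq (sub_eq_zero.1 hx)
    simpa using this
  have h3 := ProbabilityMeasure.tendsto_measure_of_null_frontier_of_tendsto' h2.tendsto
    (E := Set.Iic 0) h0
  have : IsProbabilityMeasure
      ((gaussianReal 0 1).map (fun x : ℝ => |v * d * x| - z * (v * d))) :=
    Measure.isProbabilityMeasure_map (by fun_prop)
  have h4 := (ENNReal.tendsto_toReal (measure_ne_top
    ((gaussianReal 0 1).map (fun x : ℝ => |v * d * x| - z * (v * d))) (Set.Iic 0))).comp h3
  convert! h4 using 2 with n
  · simp only [Function.comp_apply, ProbabilityMeasure.coe_mk]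
    rw [Measure.map_apply_of_aemeasurable (h2.forall_aemeasurable n) measurableSet_Iic]
    simp [Measure.real, Set.preimage]
  · rw [Measure.map_apply (by fun_prop) measurableSet_Iic]
    simp only [Measure.real, Set.preimage, Set.mem_Iic, sub_nonpos]
    congr 2
    ext x
    simp only [Set.mem_ofPred_eq]
    rw [abs_mul, abs_of_pos (mul_pos hv hd), mul_comm z, mul_le_mul_iff_right₀ (mul_pos hv hd)]

/-- Replacing events by others that agree outside negligible sets. -/
lemma tendsto_measureReal_of_inter {s t b : ℕ → Set Ω} {l : ℝ}
    (hs : Tendsto (fun n => P.real (s n)) atTop (𝓝 l))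
    (hb : Tendsto (fun n => P.real (b n)) atTop (𝓝 0))
    (hst : ∀ᶠ n in atTop, ∀ ω ∉ b n, ω ∈ s n ↔ ω ∈ t n) :
    Tendsto (fun n => P.real (t n)) atTop (𝓝 l) := by
  have h1 : Tendsto (fun n => P.real (s n) - P.real (b n)) atTop (𝓝 l) := by
    simpa using hs.sub hb
  have h2 : Tendsto (fun n => P.real (s n) + P.real (b n)) atTop (𝓝 l) := by
    simpa using hs.add hb
  refine tendsto_of_tendsto_of_tendsto_of_le_of_le' h1 h2 ?_ ?_
  · filter_upwards [hst] with n hn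
    rw [sub_le_iff_le_add]
    refine (measureReal_mono fun ω hω => ?_).trans (measureReal_union_le _ _)
    by_cases hωb : ω ∈ b n
    · exact Or.inr hωb
    · exact Or.inl ((hn ω hωb).1 hω)
  · filter_upwards [hst] with n hn
    refine (measureReal_mono fun ω hω => ?_).trans (measureReal_union_le _ _)
    by_cases hωb : ω ∈ b n
    · exact Or.inr hωb
    · exact Or.inl ((hn ω hωb).2 hω)

lemma tendsto_measureReal_nonpos {D : ℕ → Ω → ℝ} {d : ℝ} (hd : 0 < d)
    (hD : TendstoInMeasure P D atTop (fun _ => d)) :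
    Tendsto (fun n => P.real {ω | D n ω ≤ 0}) atTop (𝓝 0) := by
  have h := (tendstoInMeasure_iff_measureReal_norm.1 hD) d hd
  refine squeeze_zero (fun _ => measureReal_nonneg) (fun n => measureReal_mono fun ω hω => ?_) h
  have hω : D n ω ≤ 0 := hω
  simp only [Set.mem_ofPred_eq, Real.norm_eq_abs]
  rw [abs_of_nonpos (by linarith)]
  linarith

variable {E : Type*} [MeasurableSpace E] {κ : Measure E} {Z : ℕ → Ω → E} {h : E → ℝ}

/-- The CLT, with the limit written as a multiple of a standard normal, so that zero variance is
allowed. -/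
lemma tendstoInDistribution_sqrt_average (hZ : ∀ j, HasLaw (Z j) κ P) (hind : iIndepFun Z P)
    (hh : Measurable h) (hh2 : MemLp h 2 κ) (h0 : ∫ e, h e ∂κ = 0) :
    TendstoInDistribution (fun (n : ℕ) ω => (√n)⁻¹ * ∑ j ∈ Finset.range n, h (Z j ω)) atTop
      (fun x : ℝ => √(variance h κ) * x) (fun _ => P) (gaussianReal 0 1) := by
  have hv : variance (fun ω => h (Z 0 ω)) P = variance h κ := by
    rw [← (hZ 0).map_eq, variance_map hh.aemeasurable (hZ 0).aemeasurable]
    rfl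
  have hm : ∫ ω, h (Z 0 ω) ∂P = 0 := ((hZ 0).integral_comp hh2.aestronglyMeasurable).trans h0
  have hY : HasLaw (fun x : ℝ => √(variance h κ) * x)
      (gaussianReal 0 (variance (fun ω => h (Z 0 ω)) P).toNNReal) (gaussianReal 0 1) := by
    refine ⟨by fun_prop, ?_⟩
    rw [gaussianReal_map_const_mul, hv, mul_zero, mul_one]
    congr 1
    ext
    simp [Real.sq_sqrt, variance_nonneg]
  have := tendstoInDistribution_inv_sqrt_mul_sum_sub (X := fun j ω => h (Z j ω)) hY
    (memLp_comp_of_hasLaw (hZ 0) hh2) (hind.comp (fun _ => h) (fun _ => hh))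
    (identDistrib_comp_of_hasLaw hZ hh)
  simpa [hm] using this

/-- The `L¹` norm equals `|c| Var(h) / √n`, since a sum of `n` independent centered terms has second
moment `n Var(h)`. -/
lemma tendstoInMeasure_sqrt_mul_average_sq (hZ : ∀ j, HasLaw (Z j) κ P) (hind : iIndepFun Z P)
    (hh : Measurable h) (hh2 : MemLp h 2 κ) (h0 : ∫ e, h e ∂κ = 0) (c : ℝ) :
    TendstoInMeasure P
      (fun (n : ℕ) ω => c * (√n * (1 / (n : ℝ) * ∑ j ∈ Finset.range n, h (Z j ω)) ^ 2)) atTop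
      (fun _ => 0) := by
  have hL : ∀ j, MemLp (fun ω => h (Z j ω)) 2 P := fun j => memLp_comp_of_hasLaw (hZ j) hh2
  have hm : ∀ j, ∫ ω, h (Z j ω) ∂P = 0 := fun j =>
    ((hZ j).integral_comp hh2.aestronglyMeasurable).trans h0
  have hv : ∀ j, variance (fun ω => h (Z j ω)) P = variance h κ := fun j => by
    rw [← (hZ j).map_eq, variance_map hh.aemeasurable (hZ j).aemeasurable]
    rfl
  have hS : ∀ n, MemLp (fun ω => ∑ j ∈ Finset.range n, h (Z j ω)) 2 P := fun n =>
    memLp_finsetSum _ fun j _ => hL j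
  have hE : ∀ n : ℕ, ∫ ω, (∑ j ∈ Finset.range n, h (Z j ω)) ^ 2 ∂P = n * variance h κ := by
    intro n
    have h1 := IndepFun.variance_sum (s := Finset.range n) (fun j _ => hL j)
      (fun i _ j _ hij => (hind.indepFun hij).comp hh hh)
    simp only [hv, Finset.sum_const, Finset.card_range, nsmul_eq_mul] at h1
    rw [← h1, Finset.sum_fn, variance_of_integral_eq_zero (hS n).aemeasurable]
    rw [integral_finsetSum _ fun j _ => (hL j).integrable one_le_two]
    simp [hm]
  refine tendstoInMeasure_of_tendsto_eLpNorm one_ne_zero (fun n => ?_)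
    aestronglyMeasurable_const ?_
  · exact ((((hS n).aestronglyMeasurable.const_mul _).pow 2).const_mul _).const_mul _
  · have hlim : Tendsto (fun n : ℕ => ENNReal.ofReal (|c| * variance h κ * (√n)⁻¹)) atTop
        (𝓝 0) := by
      have : Tendsto (fun n : ℕ => |c| * variance h κ * (√n)⁻¹) atTop (𝓝 0) := by
        rw [← mul_zero (|c| * variance h κ)]
        exact tendsto_const_nhds.mul (tendsto_inv_atTop_zero.comp <|
          Real.tendsto_sqrt_atTop.comp tendsto_natCast_atTop_atTop)
      simpa using ENNReal.tendsto_ofReal this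
    refine hlim.congr fun n => ?_
    have hint : Integrable
        (fun ω => c * (√n * (1 / (n : ℝ) * ∑ j ∈ Finset.range n, h (Z j ω)) ^ 2)) P := by
      simp only [mul_pow]
      exact (((hS n).integrable_sq.const_mul _).const_mul _).const_mul _
    have hsub : ((fun ω => c * (√n * (1 / (n : ℝ) * ∑ j ∈ Finset.range n, h (Z j ω)) ^ 2)) -
        fun _ => 0) =
        (fun ω => c * (√n * (1 / (n : ℝ) * ∑ j ∈ Finset.range n, h (Z j ω)) ^ 2)) := by
      funext ω; simp
    rw [hsub, eLpNorm_one_eq_lintegral_enorm, ← ofReal_integral_norm_eq_lintegral_enorm hint]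
    congr 1
    simp only [norm_mul, norm_pow, mul_pow, Real.norm_eq_abs, sq_abs, integral_const_mul, hE]
    rw [abs_of_nonneg (Real.sqrt_nonneg _)]
    rcases Nat.eq_zero_or_pos n with rfl | hn
    · simp
    · have hn : (0 : ℝ) < n := Nat.cast_pos.2 hn
      have := Real.sq_sqrt hn.le
      have h2 := Real.sqrt_pos.2 hn
      field_simp
      rw [this]

end Asymptotics

/-! ### The pairs of inputs form an i.i.d. sequence. -/

section Sample

variable {p : ℕ} {ν : Fin p → Measure ℝ} [∀ i, IsProbabilityMeasure (ν i)]
  {Ω : Type*} [MeasurableSpace Ω] {P : Measure Ω} [IsProbabilityMeasure P]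
  {X : ℕ → Fin 2 → Fin p → Ω → ℝ}

/-- The `j`-th pair of independent input vectors. -/
def samplePair (X : ℕ → Fin 2 → Fin p → Ω → ℝ) (j : ℕ) (ω : Ω) : (Fin p → ℝ) × (Fin p → ℝ) :=
  (fun i => X j 0 i ω, fun i => X j 1 i ω)

lemma measurePreserving_infinitePi_prod :
    MeasurePreserving
      (fun b : Fin 2 × Fin p → ℝ => ((fun i => b (0, i)), (fun i => b (1, i))))
      (Measure.infinitePi fun q : Fin 2 × Fin p => ν q.2)
      ((inputLaw ν).prod (inputLaw ν)) := by
  have h1 : MeasurePreserving (MeasurableEquiv.curry (Fin 2) (Fin p) ℝ)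
      (Measure.infinitePi fun q : Fin 2 × Fin p => ν q.2)
      (Measure.pi fun _ : Fin 2 => inputLaw ν) := by
    refine ⟨(MeasurableEquiv.curry (Fin 2) (Fin p) ℝ).measurable, ?_⟩
    rw [Measure.infinitePi_map_curry (fun (_ : Fin 2) i => ν i)]
    simp only [Measure.infinitePi_eq_pi, inputLaw]
  exact (measurePreserving_piFinTwo fun _ : Fin 2 => inputLaw ν).comp h1

/-- Currying turns the product measure over all draws into a product over `j` of product measures,
which encodes both the common law and the independence of the blocks. -/
lemma samplePair_iid (hlaw : ∀ j k i, HasLaw (X j k i) (ν i) P)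
    (hindep : iIndepFun (fun q : ℕ × Fin 2 × Fin p => X q.1 q.2.1 q.2.2) P) :
    (∀ j, HasLaw (samplePair X j) ((inputLaw ν).prod (inputLaw ν)) P) ∧
      iIndepFun (samplePair X) P := by
  have h1 := hindep.hasLaw_infinitePi (μ := fun q : ℕ × Fin 2 × Fin p => ν q.2.2)
    (fun q => hlaw _ _ _) (aemeasurable_pi_iff.2 fun q => (hlaw _ _ _).aemeasurable)
  have h2 : MeasurePreserving (MeasurableEquiv.curry ℕ (Fin 2 × Fin p) ℝ)
      (Measure.infinitePi fun q : ℕ × Fin 2 × Fin p => ν q.2.2)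
      (Measure.infinitePi fun _ : ℕ => Measure.infinitePi fun q : Fin 2 × Fin p => ν q.2) :=
    ⟨(MeasurableEquiv.curry ℕ (Fin 2 × Fin p) ℝ).measurable,
      Measure.infinitePi_map_curry fun (_ : ℕ) (q : Fin 2 × Fin p) => ν q.2⟩
  have h3 : HasLaw (fun ω (j : ℕ) (q : Fin 2 × Fin p) => X j q.1 q.2 ω)
      (Measure.infinitePi fun _ : ℕ => Measure.infinitePi fun q : Fin 2 × Fin p => ν q.2) P :=
    h2.comp_hasLaw h1
  have h4 : ∀ j, HasLaw (fun ω (q : Fin 2 × Fin p) => X j q.1 q.2 ω)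
      (Measure.infinitePi fun q : Fin 2 × Fin p => ν q.2) P := fun j =>
    (measurePreserving_eval_infinitePi
      (fun _ : ℕ => Measure.infinitePi fun q : Fin 2 × Fin p => ν q.2) j).comp_hasLaw h3
  have h5 : iIndepFun (fun j ω (q : Fin 2 × Fin p) => X j q.1 q.2 ω) P :=
    (iIndepFun_iff_hasLaw_Pi_infinitePi h4 h3.aemeasurable).2 h3
  exact ⟨fun j => (measurePreserving_infinitePi_prod (ν := ν)).comp_hasLaw (h4 j),
    h5.comp (fun _ b => ((fun i => b (0, i)), (fun i => b (1, i))))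
      fun _ => (measurePreserving_infinitePi_prod (ν := ν)).measurable⟩

end Sample

/-! ### The limit variance and its degenerate case. -/

section LimitVariance

lemma mul_eq_zero_of_pairwise_mul_eq {s a b c : ℝ} (hs : 0 ≤ s) (hs1 : s ≠ 1)
    (hab : a * b = s / 2 * (a ^ 2 + b ^ 2)) (hac : a * c = s / 2 * (a ^ 2 + c ^ 2))
    (hbc : b * c = s / 2 * (b ^ 2 + c ^ 2)) : a * b = 0 := by
  have key : ∀ x : ℝ, x * x = s / 2 * (x ^ 2 + x ^ 2) → x = 0 := by
    intro x hx
    have : (1 - s) * x ^ 2 = 0 := by linear_combination hx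
    simpa [sub_eq_zero, hs1.symm] using this
  by_cases h1 : a = b
  · subst h1; rw [key a hab, mul_zero]
  by_cases h2 : a = c
  · subst h2; rw [key a hac, zero_mul]
  -- For fixed `c`, `a` and `b` are distinct roots of `s x² - 2 c x + s c² = 0`; this is the sum of
  -- the roots. `e2` is the same for `a`, `c` with `b` fixed.
  have e1 : 2 * c = s * (a + b) := by
    have : (a - b) * (2 * c - s * (a + b)) = 0 := by linear_combination 2 * hac - 2 * hbc
    exact sub_eq_zero.1 ((mul_eq_zero.1 this).resolve_left (sub_ne_zero.2 h1))
  have e2 : 2 * b = s * (a + c) := by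
    have : (a - c) * (2 * b - s * (a + c)) = 0 := by linear_combination 2 * hab - 2 * hbc
    exact sub_eq_zero.1 ((mul_eq_zero.1 this).resolve_left (sub_ne_zero.2 h2))
  have e3 : b = c := by
    have : (2 + s) * (b - c) = 0 := by linear_combination e2 - e1
    exact sub_eq_zero.1 ((mul_eq_zero.1 this).resolve_left (by positivity))
  subst e3
  rw [key b hbc, mul_zero]

variable {p : ℕ} {ν : Fin p → Measure ℝ} {f g : (Fin p → ℝ) → ℝ}

/-- The random variable whose variance is `v_u² (Var Y)²`. -/
noncomputable def gap (ν : Fin p → Measure ℝ) (f : (Fin p → ℝ) → ℝ) (u : Finset (Fin p))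
    (z : (Fin p → ℝ) × (Fin p → ℝ)) : ℝ :=
  (f z.1 - ∫ x, f x ∂(inputLaw ν)) * (f (u.piecewise z.1 z.2) - ∫ x, f x ∂(inputLaw ν))
    - closedIndex ν f u / 2 *
      ((f z.1 - ∫ x, f x ∂(inputLaw ν)) ^ 2
        + (f (u.piecewise z.1 z.2) - ∫ x, f x ∂(inputLaw ν)) ^ 2)

lemma sqrt_limitVar_mul_variance (hvar : 0 < variance f (inputLaw ν)) (u : Finset (Fin p)) :
    √(limitVar ν f u) * variance f (inputLaw ν) =
      √(variance (gap ν f u) ((inputLaw ν).prod (inputLaw ν))) := by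
  have h : limitVar ν f u = variance (gap ν f u) ((inputLaw ν).prod (inputLaw ν)) /
    (variance f (inputLaw ν)) ^ 2 := rfl
  rw [h, Real.sqrt_div (variance_nonneg _ _), Real.sqrt_sq hvar.le, div_mul_cancel₀ _ hvar.ne']

lemma memLp_sq_of_integrable_pow_four (hf : Measurable f)
    (hf4 : Integrable (fun x => f x ^ 4) (inputLaw ν)) :
    MemLp (fun x => f x ^ 2) 2 (inputLaw ν) := by
  rw [memLp_two_iff_integrable_sq (hf.pow_const 2).aestronglyMeasurable]
  simpa only [← pow_mul] using hf4

lemma measurable_comp_piecewise (hf : Measurable f) (u : Finset (Fin p)) :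
    Measurable fun z : (Fin p → ℝ) × (Fin p → ℝ) => f (u.piecewise z.1 z.2) := by
  refine hf.comp (measurable_pi_iff.2 fun i => ?_)
  by_cases hi : i ∈ u <;> simp only [Finset.piecewise, hi, if_true, if_false] <;> fun_prop

lemma measurable_gap (hf : Measurable f) (u : Finset (Fin p)) : Measurable (gap ν f u) := by
  have h1 := measurable_comp_piecewise hf u
  have h2 : Measurable fun z : (Fin p → ℝ) × (Fin p → ℝ) => f z.1 := hf.comp measurable_fst
  exact ((h2.sub_const _).mul (h1.sub_const _)).sub
    ((((h2.sub_const _).pow_const 2).add ((h1.sub_const _).pow_const 2)).const_mul _)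

variable [∀ i, IsProbabilityMeasure (ν i)]

/-- A third independent vector gives three outputs with the same coordinates in `u`; each two of
them have the joint law of `(Y, Y_u)`, so the relation holds pairwise. -/
lemma ae_mul_piecewise_eq_zero (hg : Measurable g) (u : Finset (Fin p)) {s : ℝ} (hs : 0 ≤ s)
    (hs1 : s ≠ 1)
    (h : ∀ᵐ z ∂((inputLaw ν).prod (inputLaw ν)), g z.1 * g (u.piecewise z.1 z.2) =
      s / 2 * (g z.1 ^ 2 + g (u.piecewise z.1 z.2) ^ 2)) :
    ∀ᵐ z ∂((inputLaw ν).prod (inputLaw ν)), g z.1 * g (u.piecewise z.1 z.2) = 0 := by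
  have m1 : MeasurePreserving
      (Prod.fst : ((Fin p → ℝ) × (Fin p → ℝ)) × (Fin p → ℝ) → (Fin p → ℝ) × (Fin p → ℝ))
      (((inputLaw ν).prod (inputLaw ν)).prod (inputLaw ν)) ((inputLaw ν).prod (inputLaw ν)) :=
    measurePreserving_fst
  have m2 := (measurePreserving_fst (μ := inputLaw ν) (ν := inputLaw ν)).prod
    (MeasurePreserving.id (inputLaw ν))
  have m3 := (measurePreserving_piecewise ν u).prod (MeasurePreserving.id (inputLaw ν))
  have hgu : Measurable fun z : (Fin p → ℝ) × (Fin p → ℝ) => g (u.piecewise z.1 z.2) :=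
    hg.comp (measurePreserving_piecewise ν u).measurable
  have hp : Measurable fun z : (Fin p → ℝ) × (Fin p → ℝ) =>
      g z.1 * g (u.piecewise z.1 z.2) = 0 :=
    measurableSet_setOfPred.1
      (measurableSet_eq_fun ((hg.comp measurable_fst).mul hgu) measurable_const)
  refine (m1.hasLaw.ae_iff hp).1 ?_
  filter_upwards [m1.quasiMeasurePreserving.ae h, m2.quasiMeasurePreserving.ae h,
    m3.quasiMeasurePreserving.ae h] with q h1 h2 h3
  simp only [Prod.map_fst, Prod.map_snd, id_eq] at h1 h2 h3
  have e : u.piecewise (u.piecewise q.1.1 q.1.2) q.2 = u.piecewise q.1.1 q.2 := by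
    funext i; by_cases hi : i ∈ u <;> simp [hi]
  rw [e] at h3
  exact mul_eq_zero_of_pairwise_mul_eq hs hs1 h1 h2 h3

/-- `0 = E(g² g_u²) = E(E(g² | μ_u)²)`, so `E(g² | μ_u)` vanishes a.s., and hence so does its mean
`E(g²)`. -/
lemma integral_sq_eq_zero_of_ae_mul_piecewise (hg : Measurable g)
    (hg4 : MemLp (fun x => g x ^ 2) 2 (inputLaw ν)) (u : Finset (Fin p))
    (h : ∀ᵐ z ∂((inputLaw ν).prod (inputLaw ν)), g z.1 * g (u.piecewise z.1 z.2) = 0) :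
    ∫ x, g x ^ 2 ∂(inputLaw ν) = 0 := by
  have hi := hg4.integrable one_le_two
  have hK := memLp_condMean (hg.pow_const 2) hg4 u
  have h1 : ∫ x, g x ^ 2 * condMean ν (fun x => g x ^ 2) u x ∂(inputLaw ν) = 0 := by
    rw [integral_mul_condMean hg4 hg4]
    refine integral_eq_zero_of_ae ?_
    filter_upwards [h] with z hz
    rw [← mul_pow, hz]
    simp
  have h2 : ∫ x, condMean ν (fun x => g x ^ 2) u x ^ 2 ∂(inputLaw ν) = 0 := by
    rw [← h1]
    have h3 := integral_mul_condMean_comm hg4 hK u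
    simp only [← sq] at h3
    rw [h3]
    refine integral_congr_ae ?_
    filter_upwards [condMean_condMean hi u u] with x hx
    rw [hx, Finset.inter_self]
  rw [integral_eq_zero_iff_of_nonneg (fun _ => sq_nonneg _) hK.integrable_sq] at h2
  rw [← integral_condMean hi u]
  refine integral_eq_zero_of_ae ?_
  filter_upwards [h2] with x hx
  simpa using hx

lemma memLp_two_of_memLp_sq (hf : Measurable f)
    (hf4 : MemLp (fun x => f x ^ 2) 2 (inputLaw ν)) : MemLp f 2 (inputLaw ν) :=
  (memLp_two_iff_integrable_sq hf.aestronglyMeasurable).2 (hf4.integrable one_le_two)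

lemma memLp_centered_sq (hf : Measurable f)
    (hf4 : MemLp (fun x => f x ^ 2) 2 (inputLaw ν)) :
    MemLp (fun x => (f x - ∫ x, f x ∂(inputLaw ν)) ^ 2) 2 (inputLaw ν) := by
  have := (hf4.sub ((memLp_two_of_memLp_sq hf hf4).const_mul
    (2 * ∫ x, f x ∂(inputLaw ν)))).add (memLp_const ((∫ x, f x ∂(inputLaw ν)) ^ 2))
  refine this.ae_eq (ae_of_all _ fun x => ?_)
  simp only [Pi.add_apply, Pi.sub_apply]
  ring

/-- The product is bounded by `|ab| ≤ a² + b²`, and the squares are in `L²` by the fourth moment. -/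
lemma memLp_gap (hf : Measurable f) (hf4 : MemLp (fun x => f x ^ 2) 2 (inputLaw ν))
    (u : Finset (Fin p)) : MemLp (gap ν f u) 2 ((inputLaw ν).prod (inputLaw ν)) := by
  have hg := memLp_centered_sq hf hf4
  have h1 := hg.comp_measurePreserving
    (measurePreserving_fst (μ := inputLaw ν) (ν := inputLaw ν))
  have h12 := h1.add (memLp_piecewise hg u)
  have hm : MemLp (fun z : (Fin p → ℝ) × (Fin p → ℝ) =>
      (f z.1 - ∫ x, f x ∂(inputLaw ν)) * (f (u.piecewise z.1 z.2) - ∫ x, f x ∂(inputLaw ν))) 2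
      ((inputLaw ν).prod (inputLaw ν)) := by
    refine h12.mono ?_ (ae_of_all _ fun z => ?_)
    · exact (((hf.comp measurable_fst).sub_const _).mul
        ((measurable_comp_piecewise hf u).sub_const _)).aestronglyMeasurable
    · simp only [Pi.add_apply, Function.comp_apply, Real.norm_eq_abs]
      rw [abs_mul, abs_of_nonneg (add_nonneg (sq_nonneg (f z.1 - ∫ x, f x ∂(inputLaw ν)))
        (sq_nonneg (f (u.piecewise z.1 z.2) - ∫ x, f x ∂(inputLaw ν))))]
      have := two_mul_le_add_sq |f z.1 - ∫ x, f x ∂(inputLaw ν)|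
        |f (u.piecewise z.1 z.2) - ∫ x, f x ∂(inputLaw ν)|
      rw [sq_abs, sq_abs] at this
      nlinarith [abs_nonneg (f z.1 - ∫ x, f x ∂(inputLaw ν)),
        abs_nonneg (f (u.piecewise z.1 z.2) - ∫ x, f x ∂(inputLaw ν))]
  exact hm.sub (h12.const_mul _)

lemma integral_comp_piecewise (hf : Integrable f (inputLaw ν)) (u : Finset (Fin p)) :
    ∫ z, f (u.piecewise z.1 z.2) ∂((inputLaw ν).prod (inputLaw ν)) =
      ∫ x, f x ∂(inputLaw ν) :=
  (measurePreserving_piecewise ν u).hasLaw.integral_comp hf.aestronglyMeasurable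

lemma integral_comp_fst (hf : Integrable f (inputLaw ν)) :
    ∫ z, f z.1 ∂((inputLaw ν).prod (inputLaw ν)) = ∫ x, f x ∂(inputLaw ν) :=
  measurePreserving_fst.hasLaw.integral_comp hf.aestronglyMeasurable

lemma integral_gap (hf : Measurable f) (hf2 : MemLp f 2 (inputLaw ν))
    (hvar : variance f (inputLaw ν) ≠ 0) (u : Finset (Fin p)) :
    ∫ z, gap ν f u z ∂((inputLaw ν).prod (inputLaw ν)) = 0 := by
  have hi := hf2.integrable one_le_two
  have hg : MemLp (fun x => f x - ∫ x, f x ∂(inputLaw ν)) 2 (inputLaw ν) :=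
    hf2.sub (memLp_const _)
  have i1 := (hf2.comp_measurePreserving
    (measurePreserving_fst (μ := inputLaw ν) (ν := inputLaw ν)))
  have i2 := memLp_piecewise hf2 u
  have hv : ∫ x, (f x - ∫ x, f x ∂(inputLaw ν)) ^ 2 ∂(inputLaw ν) = variance f (inputLaw ν) :=
    (variance_eq_integral hf.aemeasurable).symm
  have hc : ∫ z, (f z.1 - ∫ x, f x ∂(inputLaw ν)) *
      (f (u.piecewise z.1 z.2) - ∫ x, f x ∂(inputLaw ν)) ∂((inputLaw ν).prod (inputLaw ν)) =
      closedIndex ν f u * variance f (inputLaw ν) := by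
    have h := covariance_eq_sub i1 i2
    simp only [covariance, Function.comp_apply, Pi.mul_apply, integral_comp_piecewise hi,
      integral_comp_fst hi, integral_mul_comp_piecewise hf hf2 hvar] at h
    rw [h]
    ring
  have j1 : Integrable (fun z : (Fin p → ℝ) × (Fin p → ℝ) =>
      (f z.1 - ∫ x, f x ∂(inputLaw ν)) ^ 2) ((inputLaw ν).prod (inputLaw ν)) :=
    measurePreserving_fst.integrable_comp_of_integrable hg.integrable_sq
  have j2 := integrable_piecewise hg.integrable_sq u
  have j3 : Integrable (fun z : (Fin p → ℝ) × (Fin p → ℝ) =>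
      (f z.1 - ∫ x, f x ∂(inputLaw ν)) * (f (u.piecewise z.1 z.2) - ∫ x, f x ∂(inputLaw ν)))
      ((inputLaw ν).prod (inputLaw ν)) :=
    ((hg.comp_measurePreserving
      (measurePreserving_fst (μ := inputLaw ν) (ν := inputLaw ν)))).integrable_mul
      (memLp_piecewise hg u)
  have j4 : Integrable (fun z : (Fin p → ℝ) × (Fin p → ℝ) => closedIndex ν f u / 2 *
      ((f z.1 - ∫ x, f x ∂(inputLaw ν)) ^ 2 +
        (f (u.piecewise z.1 z.2) - ∫ x, f x ∂(inputLaw ν)) ^ 2))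
      ((inputLaw ν).prod (inputLaw ν)) := (j1.add j2).const_mul _
  unfold gap
  rw [integral_sub j3 j4, integral_const_mul, integral_add j1 j2, hc,
    integral_comp_piecewise hg.integrable_sq, integral_comp_fst hg.integrable_sq, hv]
  ring

/-- The limit variance vanishes only if the closed index is `1`. -/
lemma closedIndex_eq_one_of_ae_gap_eq_zero (hf : Measurable f)
    (hf4 : MemLp (fun x => f x ^ 2) 2 (inputLaw ν)) (hvar : variance f (inputLaw ν) ≠ 0)
    {u : Finset (Fin p)} (h : ∀ᵐ z ∂((inputLaw ν).prod (inputLaw ν)), gap ν f u z = 0) :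
    closedIndex ν f u = 1 := by
  by_contra hS
  refine hvar ?_
  have hg := memLp_centered_sq hf hf4
  rw [variance_eq_integral hf.aemeasurable]
  refine integral_sq_eq_zero_of_ae_mul_piecewise (hf.sub_const _) hg u
    (ae_mul_piecewise_eq_zero (hf.sub_const _) u (closedIndex_nonneg ν f u) hS ?_)
  filter_upwards [h] with z hz
  exact sub_eq_zero.1 hz

lemma ae_eq_comp_piecewise_of_variance_gap_eq_zero (hf : Measurable f)
    (hf4 : MemLp (fun x => f x ^ 2) 2 (inputLaw ν)) (hvar : variance f (inputLaw ν) ≠ 0)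
    {u : Finset (Fin p)}
    (h : variance (gap ν f u) ((inputLaw ν).prod (inputLaw ν)) = 0) :
    closedIndex ν f u = 1 ∧
      ∀ᵐ z ∂((inputLaw ν).prod (inputLaw ν)), f z.1 = f (u.piecewise z.1 z.2) := by
  have h0 := ae_eq_integral_of_variance_eq_zero (memLp_gap hf hf4 u) h
  rw [integral_gap hf (memLp_two_of_memLp_sq hf hf4) hvar] at h0
  have h1 := closedIndex_eq_one_of_ae_gap_eq_zero hf hf4 hvar h0
  refine ⟨h1, ?_⟩
  filter_upwards [h0] with z hz
  rw [gap, h1] at hz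
  have : (f z.1 - f (u.piecewise z.1 z.2)) ^ 2 = 0 := by linear_combination (-2) * hz
  exact sub_eq_zero.1 (pow_eq_zero_iff two_ne_zero |>.1 this)

end LimitVariance

/-! ### From the estimator to coverage probabilities. -/

section Coverage

variable {p : ℕ} {ν : Fin p → Measure ℝ} {f : (Fin p → ℝ) → ℝ}
  {Ω : Type*} {X : ℕ → Fin 2 → Fin p → Ω → ℝ}

/-- The mean of the two pick-freeze outputs, centered. -/
noncomputable def centeredMean (ν : Fin p → Measure ℝ) (f : (Fin p → ℝ) → ℝ)
    (u : Finset (Fin p)) (z : (Fin p → ℝ) × (Fin p → ℝ)) : ℝ :=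
  (f z.1 + f (u.piecewise z.1 z.2)) / 2 - ∫ x, f x ∂(inputLaw ν)

/-- The numerator of `closedEstimator`. -/
noncomputable def estimatorNum (f : (Fin p → ℝ) → ℝ) (X : ℕ → Fin 2 → Fin p → Ω → ℝ)
    (u : Finset (Fin p)) (n : ℕ) (ω : Ω) : ℝ :=
  (1 / (n : ℝ)) * ∑ j ∈ Finset.range n, output f X u j 0 ω * output f X u j 1 ω
      - ((1 / (n : ℝ)) *
          ∑ j ∈ Finset.range n, (output f X u j 0 ω + output f X u j 1 ω) / 2) ^ 2

/-- The denominator of `closedEstimator`. -/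
noncomputable def estimatorDen (f : (Fin p → ℝ) → ℝ) (X : ℕ → Fin 2 → Fin p → Ω → ℝ)
    (u : Finset (Fin p)) (n : ℕ) (ω : Ω) : ℝ :=
  (1 / (n : ℝ)) *
        ∑ j ∈ Finset.range n, (output f X u j 0 ω ^ 2 + output f X u j 1 ω ^ 2) / 2
      - ((1 / (n : ℝ)) *
          ∑ j ∈ Finset.range n, (output f X u j 0 ω + output f X u j 1 ω) / 2) ^ 2

lemma closedEstimator_eq (u : Finset (Fin p)) (n : ℕ) (ω : Ω) :
    closedEstimator f X u n ω = estimatorNum f X u n ω / estimatorDen f X u n ω := rfl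

lemma output_zero (u : Finset (Fin p)) (j : ℕ) (ω : Ω) :
    output f X u j 0 ω = f (samplePair X j ω).1 := by
  refine congrArg f (funext fun i => ?_)
  by_cases hi : i ∈ u <;> simp [hi, samplePair]

lemma output_one (u : Finset (Fin p)) (j : ℕ) (ω : Ω) :
    output f X u j 1 ω = f (u.piecewise (samplePair X j ω).1 (samplePair X j ω).2) := rfl

/-- `√n (N - S D)`, for `N` and `D` the numerator and the denominator of the estimator. -/
lemma sqrt_mul_num_sub_mul_den (u : Finset (Fin p)) {n : ℕ} (hn : 0 < n) (ω : Ω) :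
    √n * (estimatorNum f X u n ω - closedIndex ν f u * estimatorDen f X u n ω) =
      (√n)⁻¹ * ∑ j ∈ Finset.range n, gap ν f u (samplePair X j ω) +
        (closedIndex ν f u - 1) *
          (√n * (1 / (n : ℝ) * ∑ j ∈ Finset.range n, centeredMean ν f u (samplePair X j ω)) ^ 2) := by
  have hn' : (0 : ℝ) < n := Nat.cast_pos.2 hn
  have e1 : ∑ j ∈ Finset.range n, gap ν f u (samplePair X j ω) =
      ∑ j ∈ Finset.range n, output f X u j 0 ω * output f X u j 1 ω
      - closedIndex ν f u *
        ∑ j ∈ Finset.range n, (output f X u j 0 ω ^ 2 + output f X u j 1 ω ^ 2) / 2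
      - 2 * (∫ x, f x ∂(inputLaw ν)) * (1 - closedIndex ν f u) *
        ∑ j ∈ Finset.range n, (output f X u j 0 ω + output f X u j 1 ω) / 2
      + n * ((1 - closedIndex ν f u) * (∫ x, f x ∂(inputLaw ν)) ^ 2) := by
    rw [Finset.mul_sum, Finset.mul_sum, ← Finset.sum_sub_distrib, ← Finset.sum_sub_distrib]
    conv_rhs => enter [2]; rw [← Finset.card_range n, ← nsmul_eq_mul, ← Finset.sum_const]
    rw [← Finset.sum_add_distrib]
    refine Finset.sum_congr rfl fun j _ => ?_
    rw [output_zero, output_one, gap]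
    ring
  have e2 : ∑ j ∈ Finset.range n, centeredMean ν f u (samplePair X j ω) =
      ∑ j ∈ Finset.range n, (output f X u j 0 ω + output f X u j 1 ω) / 2
        - n * ∫ x, f x ∂(inputLaw ν) := by
    simp only [centeredMean, output_zero, output_one, Finset.sum_sub_distrib, Finset.sum_const,
      Finset.card_range, nsmul_eq_mul]
  rw [e1, e2, estimatorNum, estimatorDen]
  have hs : (√(n : ℝ))⁻¹ = √n * (1 / (n : ℝ)) := by
    have h2 := Real.sqrt_pos.2 hn'
    have := Real.sq_sqrt hn'.le
    field_simp
    exact this.symm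
  rw [hs]
  field_simp
  ring

/-- The error is `(N - θ D) / D`; multiplying by `√n D > 0` keeps the inequality. -/
lemma mem_confInterval_iff {α θ N D s : ℝ} {est vhat : ℕ → Ω → ℝ} {n : ℕ} {ω : Ω} (hn : 0 < n)
    (hD : 0 < D) (hest : est n ω = N / D) (hs : √n * (N - θ * D) = s) :
    θ ∈ confInterval α est vhat n ω ↔
      |s| ≤ normalQuantile (1 - α / 2) * (vhat n ω * D) := by
  have hr : 0 < √(n : ℝ) := Real.sqrt_pos.2 (Nat.cast_pos.2 hn)
  have h : est n ω - θ = s / (√n * D) := by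
    rw [hest, ← hs]
    field_simp
  have h2 : θ ∈ confInterval α est vhat n ω ↔
      |est n ω - θ| ≤ normalQuantile (1 - α / 2) * (vhat n ω / √(n : ℝ)) := by
    rw [confInterval, Set.mem_Icc, abs_le]
    constructor <;> rintro ⟨h1, h2⟩ <;> constructor <;> linarith
  rw [h2, h, abs_div, abs_of_pos (mul_pos hr hD), div_le_iff₀ (mul_pos hr hD)]
  have : normalQuantile (1 - α / 2) * (vhat n ω / √(n : ℝ)) * (√n * D) =
      normalQuantile (1 - α / 2) * (vhat n ω * D) := by field_simp
  rw [this]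

variable [MeasurableSpace Ω] {P : Measure Ω}

lemma aemeasurable_sum_samplePair (hlaw : ∀ j k i, HasLaw (X j k i) (ν i) P)
    {h : (Fin p → ℝ) × (Fin p → ℝ) → ℝ} (hh : Measurable h) (n : ℕ) :
    AEMeasurable (fun ω => ∑ j ∈ Finset.range n, h (samplePair X j ω)) P := by
  have : ∀ j, AEMeasurable (samplePair X j) P := fun j =>
    (aemeasurable_pi_iff.2 fun i => (hlaw j 0 i).aemeasurable).prodMk
      (aemeasurable_pi_iff.2 fun i => (hlaw j 1 i).aemeasurable)
  exact Finset.aemeasurable_fun_sum _ fun j _ => hh.comp_aemeasurable (this j)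

lemma aemeasurable_estimatorDen (hf : Measurable f) (hlaw : ∀ j k i, HasLaw (X j k i) (ν i) P)
    (u : Finset (Fin p)) (n : ℕ) : AEMeasurable (estimatorDen f X u n) P := by
  have h1 := measurable_comp_piecewise hf u
  have h2 : Measurable fun z : (Fin p → ℝ) × (Fin p → ℝ) => f z.1 := hf.comp measurable_fst
  unfold estimatorDen
  simp only [output_zero, output_one]
  exact ((aemeasurable_sum_samplePair hlaw
    (((h2.pow_const 2).add (h1.pow_const 2)).div_const 2) n).const_mul _).sub
    (((aemeasurable_sum_samplePair hlaw ((h2.add h1).div_const 2) n).const_mul _).pow_const 2)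

variable [∀ i, IsProbabilityMeasure (ν i)] [IsProbabilityMeasure P]

lemma tendstoInMeasure_estimatorDen (hf : Measurable f) (hf2 : MemLp f 2 (inputLaw ν))
    (hlaw : ∀ j k i, HasLaw (X j k i) (ν i) P)
    (hindep : iIndepFun (fun q : ℕ × Fin 2 × Fin p => X q.1 q.2.1 q.2.2) P)
    (u : Finset (Fin p)) :
    TendstoInMeasure P (estimatorDen f X u) atTop (fun _ => variance f (inputLaw ν)) := by
  obtain ⟨hZ, hind⟩ := samplePair_iid hlaw hindep
  have h1 := measurable_comp_piecewise hf u
  have h2 : Measurable fun z : (Fin p → ℝ) × (Fin p → ℝ) => f z.1 := hf.comp measurable_fst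
  have hi := hf2.integrable one_le_two
  have i1 : Integrable (fun z : (Fin p → ℝ) × (Fin p → ℝ) => f z.1)
    ((inputLaw ν).prod (inputLaw ν)) := measurePreserving_fst.integrable_comp_of_integrable hi
  have i2 := integrable_piecewise hi u
  have j1 : Integrable (fun z : (Fin p → ℝ) × (Fin p → ℝ) => f z.1 ^ 2)
    ((inputLaw ν).prod (inputLaw ν)) :=
    measurePreserving_fst.integrable_comp_of_integrable hf2.integrable_sq
  have j2 := integrable_piecewise hf2.integrable_sq u
  refine tendstoInMeasure_of_tendsto_ae
    (fun n => (aemeasurable_estimatorDen hf hlaw u n).aestronglyMeasurable) ?_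
  filter_upwards [ae_tendsto_average hZ hind (((h2.pow_const 2).add (h1.pow_const 2)).div_const 2)
    ((j1.add j2).div_const 2), ae_tendsto_average hZ hind ((h2.add h1).div_const 2)
    ((i1.add i2).div_const 2)] with ω k1 k2
  have := k1.sub (k2.pow 2)
  simp only [Pi.add_apply, integral_div, integral_add j1 j2, integral_add i1 i2,
    integral_comp_piecewise hi, integral_comp_piecewise hf2.integrable_sq, integral_comp_fst hi,
    integral_comp_fst hf2.integrable_sq, add_self_div_two] at this
  rw [variance_eq_sub hf2]
  simpa only [estimatorDen, output_zero, output_one, Pi.pow_apply] using this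

lemma tendstoInDistribution_sqrt_mul (hf : Measurable f)
    (hf4 : MemLp (fun x => f x ^ 2) 2 (inputLaw ν)) (hvar : 0 < variance f (inputLaw ν))
    (hlaw : ∀ j k i, HasLaw (X j k i) (ν i) P)
    (hindep : iIndepFun (fun q : ℕ × Fin 2 × Fin p => X q.1 q.2.1 q.2.2) P)
    (u : Finset (Fin p)) :
    TendstoInDistribution (fun (n : ℕ) ω =>
      (√n)⁻¹ * ∑ j ∈ Finset.range n, gap ν f u (samplePair X j ω) +
        (closedIndex ν f u - 1) *
          (√n * (1 / (n : ℝ) * ∑ j ∈ Finset.range n, centeredMean ν f u (samplePair X j ω)) ^ 2))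
      atTop (fun x : ℝ => √(limitVar ν f u) * variance f (inputLaw ν) * x) (fun _ => P)
      (gaussianReal 0 1) := by
  obtain ⟨hZ, hind⟩ := samplePair_iid hlaw hindep
  have hf2 := memLp_two_of_memLp_sq hf hf4
  have hi := hf2.integrable one_le_two
  have h1 := measurable_comp_piecewise hf u
  have h2 : Measurable fun z : (Fin p → ℝ) × (Fin p → ℝ) => f z.1 := hf.comp measurable_fst
  have i1 : MemLp (fun z : (Fin p → ℝ) × (Fin p → ℝ) => f z.1) 2
    ((inputLaw ν).prod (inputLaw ν)) := hf2.comp_measurePreserving measurePreserving_fst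
  have i2 := memLp_piecewise hf2 u
  have hc : Measurable (centeredMean ν f u) := ((h2.add h1).div_const 2).sub_const _
  have i3 : MemLp (fun z : (Fin p → ℝ) × (Fin p → ℝ) => (f z.1 + f (u.piecewise z.1 z.2)) / 2) 2
      ((inputLaw ν).prod (inputLaw ν)) := by
    simpa only [div_eq_mul_inv, Pi.add_apply] using (i1.add i2).mul_const (2⁻¹ : ℝ)
  have hc2 : MemLp (centeredMean ν f u) 2 ((inputLaw ν).prod (inputLaw ν)) :=
    i3.sub (memLp_const _)
  have hc0 : ∫ z, centeredMean ν f u z ∂((inputLaw ν).prod (inputLaw ν)) = 0 := by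
    unfold centeredMean
    rw [integral_sub (i3.integrable one_le_two) (integrable_const _), integral_div,
      integral_add (i1.integrable one_le_two) (i2.integrable one_le_two),
      integral_comp_fst hi, integral_comp_piecewise hi]
    simp
  have hW := tendstoInDistribution_sqrt_average hZ hind (measurable_gap hf u) (memLp_gap hf hf4 u)
    (integral_gap hf hf2 hvar.ne' u)
  have hR := tendstoInMeasure_sqrt_mul_average_sq hZ hind hc hc2 hc0 (closedIndex ν f u - 1)
  have := hW.add_of_tendstoInMeasure_const hR fun n =>
    (((aemeasurable_sum_samplePair hlaw hc n).const_mul _).pow_const 2 |>.const_mul _).const_mul _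
  rw [sqrt_limitVar_mul_variance hvar]
  simpa using! this

lemma isAsymptoticCI_closedIndex (hf : Measurable f)
    (hf4 : MemLp (fun x => f x ^ 2) 2 (inputLaw ν)) (hvar : 0 < variance f (inputLaw ν))
    (hlaw : ∀ j k i, HasLaw (X j k i) (ν i) P)
    (hindep : iIndepFun (fun q : ℕ × Fin 2 × Fin p => X q.1 q.2.1 q.2.2) P)
    {α : ℝ} (hα : α ∈ Set.Ioo (0 : ℝ) 1) (u : Finset (Fin p)) {vhat : ℕ → Ω → ℝ}
    (hv : IsConsistent P vhat (√(limitVar ν f u))) (hpos : 0 < limitVar ν f u) :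
    IsAsymptoticCI P (confInterval α (closedEstimator f X u) vhat) (closedIndex ν f u)
      (1 - α) := by
  have hD := tendstoInMeasure_estimatorDen hf (memLp_two_of_memLp_sq hf hf4) hlaw hindep u
  have h := tendsto_measureReal_abs_le (z := normalQuantile (1 - α / 2)) hvar
    (Real.sqrt_pos.2 hpos) (tendstoInDistribution_sqrt_mul hf hf4 hvar hlaw hindep u) hD
    (aemeasurable_estimatorDen hf hlaw u) hv.2 hv.1
  have hq : 1 - α / 2 ∈ Set.Ioo (2⁻¹ : ℝ) 1 := ⟨by linarith [hα.2], by linarith [hα.1]⟩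
  rw [gaussianReal_abs_le (normalQuantile_nonneg hq),
    cdf_normalQuantile ⟨by linarith [hα.2], hq.2⟩,
    show 2 * (1 - α / 2) - 1 = 1 - α by ring] at h
  -- Clearing denominators is legitimate off `{D ≤ 0}`, whose probability tends to `0`.
  refine tendsto_measureReal_of_inter h (tendsto_measureReal_nonpos hvar hD) ?_
  filter_upwards [eventually_gt_atTop 0] with n hn ω hω
  exact (mem_confInterval_iff hn (not_le.1 hω) (closedEstimator_eq u n ω)
    (sqrt_mul_num_sub_mul_den u hn ω)).symm

lemma isAsymptoticCIAtLeast_closedIndex (hf : Measurable f)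
    (hf4 : MemLp (fun x => f x ^ 2) 2 (inputLaw ν)) (hvar : 0 < variance f (inputLaw ν))
    (hlaw : ∀ j k i, HasLaw (X j k i) (ν i) P)
    (hindep : iIndepFun (fun q : ℕ × Fin 2 × Fin p => X q.1 q.2.1 q.2.2) P)
    {α : ℝ} (hα : α ∈ Set.Ioo (0 : ℝ) 1) (u : Finset (Fin p)) {vhat : ℕ → Ω → ℝ}
    (hv : IsConsistent P vhat (√(limitVar ν f u))) (hv0 : ∀ n, ∀ᵐ ω ∂P, 0 ≤ vhat n ω) :
    IsAsymptoticCIAtLeast P (confInterval α (closedEstimator f X u) vhat) (closedIndex ν f u)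
      (1 - α) := by
  intro c hc
  have hnn : 0 ≤ limitVar ν f u := div_nonneg (variance_nonneg _ _) (sq_nonneg _)
  rcases hnn.lt_or_eq with hpos | h0
  · exact (isAsymptoticCI_closedIndex hf hf4 hvar hlaw hindep hα u hv hpos).eventually_const_lt hc
  have hgap : variance (gap ν f u) ((inputLaw ν).prod (inputLaw ν)) = 0 := by
    have := sqrt_limitVar_mul_variance hvar u
    rw [← h0, Real.sqrt_zero, zero_mul] at this
    exact (Real.sqrt_eq_zero (variance_nonneg _ _)).1 this.symm
  obtain ⟨hS, hae⟩ := ae_eq_comp_piecewise_of_variance_gap_eq_zero hf hf4 hvar.ne' hgap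
  obtain ⟨hZ, -⟩ := samplePair_iid hlaw hindep
  have hq : 1 - α / 2 ∈ Set.Ioo (2⁻¹ : ℝ) 1 := ⟨by linarith [hα.2], by linarith [hα.1]⟩
  have hz := normalQuantile_nonneg hq
  have hout : ∀ᵐ ω ∂P, ∀ j, output f X u j 0 ω = output f X u j 1 ω := by
    refine ae_all_iff.2 fun j => ?_
    have := (hZ j).map_eq ▸ hae
    simpa only [output_zero, output_one] using ae_of_ae_map (hZ j).aemeasurable this
  have hD := tendsto_measureReal_nonpos hvar
    (tendstoInMeasure_estimatorDen hf (memLp_two_of_memLp_sq hf hf4) hlaw hindep u)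
  have hlim : Tendsto (fun n => 1 - P.real {ω | estimatorDen f X u n ω ≤ 0}) atTop (𝓝 1) := by
    simpa using tendsto_const_nhds.sub hD
  -- In the degenerate case coverage holds a.s. on `{D > 0}`, so its probability tends to `1 > c`.
  filter_upwards [hlim.eventually_const_lt (show c < 1 by linarith [hα.1])] with n hn
  refine hn.trans_le ?_
  rw [← probReal_compl_eq_one_sub₀ (nullMeasurableSet_le
    (aemeasurable_estimatorDen hf hlaw u n) aemeasurable_const)]
  refine ENNReal.toReal_mono (measure_ne_top _ _) (measure_mono_ae ?_)
  filter_upwards [hout, hv0 n] with ω h1 h2 hω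
  have hden : 0 < estimatorDen f X u n ω := not_le.1 hω
  have hnum : estimatorNum f X u n ω = estimatorDen f X u n ω := by
    simp only [estimatorNum, estimatorDen, h1, ← sq, add_self_div_two]
  have hest : closedEstimator f X u n ω = 1 := by
    rw [closedEstimator_eq, hnum, div_self hden.ne']
  have : 0 ≤ normalQuantile (1 - α / 2) * (vhat n ω / √(n : ℝ)) := by positivity
  change closedIndex ν f u ∈ Set.Icc _ _
  rw [hS, hest]
  exact ⟨by linarith, by linarith⟩

end Coverage

/-- The interval is symmetric about the estimate, so reflecting both estimate and target preserves
membership. -/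
lemma mem_confInterval_one_sub {Ω : Type*} {α θ : ℝ} {est vhat : ℕ → Ω → ℝ} {n : ℕ} {ω : Ω} :
    1 - θ ∈ confInterval α (fun n ω => 1 - est n ω) vhat n ω ↔
      θ ∈ confInterval α est vhat n ω := by
  simp only [confInterval, Set.mem_Icc]
  constructor <;> rintro ⟨h1, h2⟩ <;> constructor <;> linarith

end Sobol

theorem theorem1 {p : ℕ} (ν : Fin p → Measure ℝ) [∀ i, IsProbabilityMeasure (ν i)]
    (f : (Fin p → ℝ) → ℝ) (hf : Measurable f)
    (hf4 : Integrable (fun x => f x ^ 4) (Sobol.inputLaw ν))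
    (hvar : 0 < variance f (Sobol.inputLaw ν))
    {Ω : Type*} [MeasurableSpace Ω] (P : Measure Ω) [IsProbabilityMeasure P]
    (X : ℕ → Fin 2 → Fin p → Ω → ℝ)
    (hlaw : ∀ j k i, HasLaw (X j k i) (ν i) P)
    (hindep : iIndepFun (fun q : ℕ × Fin 2 × Fin p => X q.1 q.2.1 q.2.2) P)
    (α : ℝ) (hα : α ∈ Set.Ioo (0 : ℝ) 1) :
    (∀ (u : Finset (Fin p)) (vhat : ℕ → Ω → ℝ),
      Sobol.IsConsistent P vhat (√(Sobol.limitVar ν f u)) →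
        (0 < Sobol.limitVar ν f u →
          Sobol.IsAsymptoticCI P
            (Sobol.confInterval α (Sobol.closedEstimator f X u) vhat)
            (Sobol.closedIndex ν f u) (1 - α)) ∧
        ((∀ n, ∀ᵐ ω ∂P, 0 ≤ vhat n ω) →
          Sobol.IsAsymptoticCIAtLeast P
            (Sobol.confInterval α (Sobol.closedEstimator f X u) vhat)
            (Sobol.closedIndex ν f u) (1 - α))) ∧
    (∀ (i : Fin p) (vhat : ℕ → Ω → ℝ),
      Sobol.IsConsistent P vhat (√(Sobol.limitVar ν f {i}ᶜ)) →
        (0 < Sobol.limitVar ν f {i}ᶜ →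
          Sobol.IsAsymptoticCI P
            (Sobol.confInterval α (Sobol.totalEstimator f X i) vhat)
            (Sobol.totalIndex ν f i) (1 - α)) ∧
        ((∀ n, ∀ᵐ ω ∂P, 0 ≤ vhat n ω) →
          Sobol.IsAsymptoticCIAtLeast P
            (Sobol.confInterval α (Sobol.totalEstimator f X i) vhat)
            (Sobol.totalIndex ν f i) (1 - α))) := by
  have hsq := Sobol.memLp_sq_of_integrable_pow_four hf hf4
  have key : ∀ (u : Finset (Fin p)) (vhat : ℕ → Ω → ℝ),
      Sobol.IsConsistent P vhat (√(Sobol.limitVar ν f u)) →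
        (0 < Sobol.limitVar ν f u →
          Sobol.IsAsymptoticCI P
            (Sobol.confInterval α (Sobol.closedEstimator f X u) vhat)
            (Sobol.closedIndex ν f u) (1 - α)) ∧
        ((∀ n, ∀ᵐ ω ∂P, 0 ≤ vhat n ω) →
          Sobol.IsAsymptoticCIAtLeast P
            (Sobol.confInterval α (Sobol.closedEstimator f X u) vhat)
            (Sobol.closedIndex ν f u) (1 - α)) := fun u vhat hv =>
    ⟨Sobol.isAsymptoticCI_closedIndex hf hsq hvar hlaw hindep hα u hv,
      Sobol.isAsymptoticCIAtLeast_closedIndex hf hsq hvar hlaw hindep hα u hv⟩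
  refine ⟨key, fun i vhat hv => ?_⟩
  have hset : ∀ n, {ω | Sobol.totalIndex ν f i ∈
        Sobol.confInterval α (Sobol.totalEstimator f X i) vhat n ω} =
      {ω | Sobol.closedIndex ν f {i}ᶜ ∈
        Sobol.confInterval α (Sobol.closedEstimator f X {i}ᶜ) vhat n ω} := fun n => by
    rw [Sobol.totalIndex_eq hf (Sobol.memLp_two_of_memLp_sq hf hsq) hvar.ne' i]
    ext ω
    exact Sobol.mem_confInterval_one_sub
  simpa only [Sobol.IsAsymptoticCI, Sobol.IsAsymptoticCIAtLeast, hset] using key {i}ᶜ vhat hv
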